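/- All Hilbert spaces are complex, inner products are linear in the first argument, and $\mathcal G^*$ denotes the anti-dual of $\mathcal G$ (bounded conjugate-linear functionals), with Riesz isomorphism $\mathcal R_{\mathcal G}:\mathcal G\to\mathcal G^*$, $\mathcal R_{\mathcal G}x=\langle x,\cdot\rangle$. **Setting.** Let $\mathcal X,\mathcal Y,\mathcal G_1,\mathcal G_2$ be Hilbert spaces and let $A:\mathcal X\supset\operatorname{dom}A\to\mathcal Y$ be closed and densely defined with $\|Ax\|\ge c\|x\|$ on $\operatorname{dom}A$ for some $c>0$ (equivalently, $S=A^*A$ is uniformly positive). Let $B:\mathcal Y\supset\operatorname{dom}B\to\mathcal X$ be closed and densely defined with $A^*\subset -B$. Let $M\in L(\mathcal X)$ be self-adjoint and uniformly positive ($\langle Mx,x\rangle\ge\alpha\|x\|^2$ for some $\alpha>0$), and let $D\in L(\mathcal X)$ satisfy $\operatorname{Re}\langle Dx,x\rangle\ge 0$. Let $\mathcal X_h=\operatorname{dom}A$ with inner product $\langle Ax,Ay\rangle_{\mathcal Y}$, let $\mathcal Y_1=\operatorname{ran}A$ with the inner product of $\mathcal Y$, and let $\mathcal X_M=\mathcal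 X$ with inner product $\langle M^{-1}x,y\rangle_{\mathcal X}$. Let $\Lambda=(\Lambda_1,\Lambda_2):\operatorname{dom}A\to\mathcal G_1\times\mathcal G_2^*$ and $\Pi=(\Pi_1,\Pi_2):\operatorname{dom}B\to\mathcal G_1^*\times\mathcal G_2$ be a boundary triplet for the dual pair $(A^*,-B^*)$, i.e. $\Lambda$ and $\Pi$ are linear and surjective and $$-\langle By,x\rangle_{\mathcal X}-\langle y,Ax\rangle_{\mathcal Y}=\langle\Pi_1y,\Lambda_1x\rangle_{\mathcal G_1^*,\mathcal G_1}-\langle\Pi_2y,\Lambda_2x\rangle_{\mathcal G_2,\mathcal G_2^*}\qquad(y\in\operatorname{dom}B,\ x\in\operatorname{dom}A).$$ Put $\mathcal G=\mathcal G_1\times\mathcal G_2$ and let $P\in L(\mathcal G^*)$ with $\|P\|\le 1$. **The two nodes.** The position–momentum node $N$ has state space $\mathcal X_h\times\mathcal X_M$ and interior operator $$\mathcal A_M=\begin{bmatrix}0&M^{-1}\\ BA&-DM^{-1}\end{bmatrix},\qquad \operatorname{dom}\mathcal A_M=\{(z_1,z_2)\in\mathcal X_h\times M\mathcal X_h: Az_1\in\operatorname{dom}B\}.$$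 The strain–momentum node $L$ has state space $\mathcal Y_1\times\mathcal X_M$ and interior operator $$\mathcal B_M=\begin{bmatrix}0&AM^{-1}\\ B&-DM^{-1}\end{bmatrix},\qquad \operatorname{dom}\mathcal B_M=(\operatorname{dom}B\cap\mathcal Y_1)\times M\mathcal X_h .$$ With $\Gamma_0z=(\Lambda_1z_2,\Pi_2Az_1)$, $\Gamma_1z=(-\Pi_1Az_1,\Lambda_2z_2)$, $\Xi_0w=(\Lambda_1w_2,\Pi_2w_1)$, $\Xi_1w=(-\Pi_1w_1,\Lambda_2w_2)$, the input and output operators of $N$ are $$\tfrac12\big((1-P)\mathcal R_{\mathcal G}\Gamma_0+(1+P)\Gamma_1\big)\begin{bmatrix}I&0\\0&M^{-1}\end{bmatrix},\qquad \tfrac12\big((1+P)\mathcal R_{\mathcal G}\Gamma_0+(1-P)\Gamma_1\big)\begin{bmatrix}I&0\\0&M^{-1}\end{bmatrix},$$ and those of $L$ are the same expressions with $\Xi_0,\Xi_1$ in place of $\Gamma_0,\Gamma_1$. A classical solution $(u,z,y)$ of a node with state space $\mathcal Z$, input operator $G$, interior operator $\mathcal L$ and output operator $K$ consists of $u\in C^2(\mathbb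 R_{\ge0};\mathcal G^*)$, $z\in C^1(\mathbb R_{\ge0};\mathcal Z)\cap C(\mathbb R_{\ge0};\operatorname{dom}\mathcal L)$ (graph norm of $\mathcal L$ on $\operatorname{dom}\mathcal L$) and $y\in C(\mathbb R_{\ge0};\mathcal G^*)$ with $u(t)=Gz(t)$, $\dot z(t)=\mathcal Lz(t)$, $y(t)=Kz(t)$ for all $t\ge0$. **Corollary 3.12.** Let $z_0\in\mathcal X_h\times\mathcal X_M$ and let $(u,z,y)$ be a classical solution of $N$ with $z(0)=z_0$. Then $(u,z,y)$ is the only classical solution of $N$ with input $u$ and initial state $z_0$. Moreover, $$\Big(u,\begin{bmatrix}A&0\\0&I\end{bmatrix}z,\;y\Big)$$ is a classical solution of $L$ with initial state $\begin{bmatrix}A&0\\0&I\end{bmatrix}z_0$, and it is the only one with input $u$ and this initial state: if $(u,w,v)$ is a classical solution of $L$ with $w(0)=\begin{bmatrix}A&0\\0&I\end{bmatrix}z_0$, then $w=\begin{bmatrix}A&0\\0&I\end{bmatrix}z$ and $v=y$ on $\mathbb R_{\ge0}$. -/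

import Mathlib

open scoped InnerProductSpace

noncomputable section

namespace SecondOrder

/-! ### Anti-duals -/

/-- The anti-dual of `G`: bounded conjugate-linear functionals, with the operator norm.
The duality pairing `⟨f, g⟩` between the anti-dual and `G` is `f g`. -/
abbrev AntiDual (G : Type*) [NormedAddCommGroup G] [InnerProductSpace ℂ G] : Type _ :=
  G →L⋆[ℂ] ℂ

/-- The (linear) Riesz map `G → G^*`, sending `x` to `g ↦ ⟨x, g⟩`, where `⟨·, ·⟩` is linear in
its first argument (that is, `⟨x, g⟩` is Mathlib's `⟪g, x⟫_ℂ`). -/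
def riesz (G : Type*) [NormedAddCommGroup G] [InnerProductSpace ℂ G] : G →L[ℂ] AntiDual G :=
  innerSLFlip ℂ

/-- The identification of `G₁^* × G₂^*` with the anti-dual of the Hilbert space `G₁ × G₂`. -/
def antiDualProd (G₁ G₂ : Type*) [NormedAddCommGroup G₁] [InnerProductSpace ℂ G₁]
    [NormedAddCommGroup G₂] [InnerProductSpace ℂ G₂] :
    (AntiDual G₁ × AntiDual G₂) →ₗ[ℂ] AntiDual (WithLp 2 (G₁ × G₂)) where
  toFun f := f.1.comp (WithLp.fstL 2 ℂ G₁ G₂) + f.2.comp (WithLp.sndL 2 ℂ G₁ G₂)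
  map_add' f g := by ext x; simp; ring
  map_smul' c f := by ext x; simp

/-! ### Colligations and their classical solutions -/

/-- A colligation on `(U, Z, V)`: three linear maps, the input boundary operator `G`, the interior
operator `L` and the output boundary operator `K`, on a common domain in the state space `Z`. -/
structure Colligation (U Z V : Type*) [NormedAddCommGroup U] [NormedSpace ℂ U]
    [NormedAddCommGroup Z] [NormedSpace ℂ Z] [NormedAddCommGroup V] [NormedSpace ℂ V] where
  dom : Submodule ℂ Z
  G : dom →ₗ[ℂ] U
  L : dom →ₗ[ℂ] Z
  K : dom →ₗ[ℂ] V

/-- `(u, z, y)` is a classical (smooth) solution on `[0, ∞)` of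
`u(t) = G z(t)`, `z'(t) = L z(t)`, `y(t) = K z(t)`. The functions live on `ℝ`, but only their
values on `[0, ∞)` matter; derivatives at `0` are one-sided. -/
structure Colligation.IsClassicalSolution {U Z V : Type*}
    [NormedAddCommGroup U] [NormedSpace ℂ U] [NormedAddCommGroup Z] [NormedSpace ℂ Z]
    [NormedAddCommGroup V] [NormedSpace ℂ V] (Θ : Colligation U Z V)
    (u : ℝ → U) (z : ℝ → Z) (y : ℝ → V) : Prop where
  contDiffOn_input : ContDiffOn ℝ 2 u (Set.Ici 0)
  contDiffOn_state : ContDiffOn ℝ 1 z (Set.Ici 0)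
  continuousOn_output : ContinuousOn y (Set.Ici 0)
  mem_dom : ∀ t : Set.Ici (0 : ℝ), z t ∈ Θ.dom
  /-- continuity with values in `dom L`, equipped with the graph norm of `L` -/
  continuous_graph : Continuous fun t : Set.Ici (0 : ℝ) => (z t, Θ.L ⟨z t, mem_dom t⟩)
  input_eq : ∀ t : Set.Ici (0 : ℝ), u t = Θ.G ⟨z t, mem_dom t⟩
  state_eq : ∀ t : Set.Ici (0 : ℝ),
    HasDerivWithinAt z (Θ.L ⟨z t, mem_dom t⟩) (Set.Ici 0) t
  output_eq : ∀ t : Set.Ici (0 : ℝ), y t = Θ.K ⟨z t, mem_dom t⟩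

/-! ### The second order system and its state spaces -/

/-- The data of the abstract second order system `M x'' + D x' - B A x = 0`. -/
structure System (X Y : Type*) [NormedAddCommGroup X] [InnerProductSpace ℂ X] [CompleteSpace X]
    [NormedAddCommGroup Y] [InnerProductSpace ℂ Y] [CompleteSpace Y] where
  A : X →ₗ.[ℂ] Y
  B : Y →ₗ.[ℂ] X
  M : X →L[ℂ] X
  D : X →L[ℂ] X
  closed_A : A.IsClosed
  dense_A : Dense (A.domain : Set X)
  /-- `A^* A` is uniformly positive, i.e. its form `h(x, y) = ⟨A x, A y⟩` is coercive -/
  coercive_A : ∃ c : ℝ, 0 < c ∧ ∀ x : A.domain, c * ‖(x : X)‖ ≤ ‖A x‖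
  closed_B : B.IsClosed
  dense_B : Dense (B.domain : Set Y)
  /-- `B` extends `-A^*`, so that `(A^*, -B^*)` is a dual pair -/
  adjoint_le : A.adjoint ≤ -B
  selfAdjoint_M : IsSelfAdjoint M
  unifPos_M : ∃ c : ℝ, 0 < c ∧ ∀ x : X, c * ‖x‖ ^ 2 ≤ (⟪M x, x⟫_ℂ).re
  /-- `-D` is dissipative -/
  dissipative_D : ∀ x : X, (⟪-D x, x⟫_ℂ).re ≤ 0

namespace System

section Spaces

variable {X Y : Type*} [NormedAddCommGroup X] [InnerProductSpace ℂ X] [CompleteSpace X]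
  [NormedAddCommGroup Y] [InnerProductSpace ℂ Y] [CompleteSpace Y] (S : System X Y)

/-- The bounded inverse of the density operator `M` (see `isUnit_M`). -/
def Minv : X →L[ℂ] X := Ring.inverse S.M

theorem isUnit_M : IsUnit S.M := by
  obtain ⟨c, hc, h⟩ := S.unifPos_M
  refine ContinuousLinearMap.isUnit_of_forall_le_norm_inner_map S.M (c := ⟨c, hc.le⟩) hc
    fun x => ?_
  calc ‖x‖ ^ 2 * c = c * ‖x‖ ^ 2 := mul_comm _ _
    _ ≤ (⟪S.M x, x⟫_ℂ).re := h x
    _ ≤ ‖⟪S.M x, x⟫_ℂ‖ := Complex.re_le_norm _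

theorem M_Minv (x : X) : S.M (S.Minv x) = x :=
  DFunLike.congr_fun (Ring.mul_inverse_cancel S.M S.isUnit_M) x

theorem Minv_M (x : X) : S.Minv (S.M x) = x :=
  DFunLike.congr_fun (Ring.inverse_mul_cancel S.M S.isUnit_M) x

theorem inner_Minv_symm (x y : X) : ⟪S.Minv x, y⟫_ℂ = ⟪x, S.Minv y⟫_ℂ := by
  have h := S.selfAdjoint_M.isSymmetric (S.Minv x) (S.Minv y)
  rw [ContinuousLinearMap.coe_coe, M_Minv, M_Minv] at h
  exact h.symm

theorem inner_Minv_self (x : X) : ∃ c : ℝ, 0 < c ∧ c * ‖S.Minv x‖ ^ 2 ≤ (⟪S.Minv x, x⟫_ℂ).re := by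
  obtain ⟨c, hc, h⟩ := S.unifPos_M
  refine ⟨c, hc, ?_⟩
  have h1 := h (S.Minv x)
  rwa [M_Minv, ← inner_Minv_symm] at h1

/-- The energy space: `dom A` with the inner product `⟨A x, A y⟩`. -/
def Xh : Type _ := S.A.domain

instance : AddCommGroup S.Xh := inferInstanceAs (AddCommGroup S.A.domain)

instance : Module ℂ S.Xh := inferInstanceAs (Module ℂ S.A.domain)

/-- The identity from `dom A` to the energy space. -/
def toXh : S.A.domain →ₗ[ℂ] S.Xh := LinearMap.id

/-- `A` as a map on the energy space. -/
def AXh : S.Xh →ₗ[ℂ] Y := S.A.toFun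

theorem AXh_injective : Function.Injective S.AXh := by
  obtain ⟨c, hc, h⟩ := S.coercive_A
  refine (injective_iff_map_eq_zero S.AXh).2 fun x hx => ?_
  have h1 := h (show S.A.domain from x)
  have h2 : S.A (show S.A.domain from x) = 0 := hx
  rw [h2, norm_zero] at h1
  exact Subtype.ext (norm_le_zero_iff.1 (nonpos_of_mul_nonpos_right h1 hc))

instance : NormedAddCommGroup S.Xh :=
  NormedAddCommGroup.induced S.Xh Y S.AXh S.AXh_injective

instance : InnerProductSpace ℂ S.Xh where
  norm_smul_le c x := by
    change ‖S.AXh (c • x)‖ ≤ ‖c‖ * ‖S.AXh x‖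
    rw [map_smul]; exact norm_smul_le _ _
  inner x y := ⟪S.AXh x, S.AXh y⟫_ℂ
  norm_sq_eq_re_inner x := norm_sq_eq_re_inner (𝕜 := ℂ) (S.AXh x)
  conj_inner_symm x y := inner_conj_symm _ _
  add_left x y w := by simp only [map_add, inner_add_left]
  smul_left x y c := by simp only [map_smul, inner_smul_left]

/-- The range of `A`, with the inner product of `Y`. -/
abbrev Y1 : Submodule ℂ Y := LinearMap.range S.A.toFun

/-- `A` as a map from the energy space onto its range. -/
def AY1 : S.Xh →ₗ[ℂ] S.Y1 := LinearMap.rangeRestrict S.A.toFun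

/-- The space `X` with the inner product `⟨M⁻¹ x, y⟩`. -/
def XM (_S : System X Y) : Type _ := X

instance : AddCommGroup S.XM := inferInstanceAs (AddCommGroup X)

instance : Module ℂ S.XM := inferInstanceAs (Module ℂ X)

/-- The identity from the weighted space to `X`. -/
def ofXM : S.XM →ₗ[ℂ] X := LinearMap.id

/-- The identity from `X` to the weighted space. -/
def toXM : X →ₗ[ℂ] S.XM := LinearMap.id

/-- `M⁻¹`, from the weighted space to `X`. -/
def MinvXM : S.XM →ₗ[ℂ] X := S.Minv.toLinearMap ∘ₗ S.ofXM

/-- The inner product `⟨M⁻¹ x, y⟩` on `X`. -/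
@[reducible]
def coreXM : InnerProductSpace.Core ℂ S.XM where
  inner x y := ⟪S.MinvXM x, S.ofXM y⟫_ℂ
  conj_inner_symm x y := by
    rw [inner_conj_symm]
    exact (S.inner_Minv_symm (S.ofXM x) (S.ofXM y)).symm
  re_inner_nonneg x := by
    obtain ⟨c, hc, h⟩ := S.inner_Minv_self (S.ofXM x)
    exact le_trans (by positivity) h
  add_left x y w := by simp only [map_add, inner_add_left]
  smul_left x y r := by simp only [map_smul, inner_smul_left]
  definite x hx := by
    obtain ⟨c, hc, h⟩ := S.inner_Minv_self (S.ofXM x)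
    have hx' : ⟪S.Minv (S.ofXM x), S.ofXM x⟫_ℂ = 0 := hx
    rw [hx', Complex.zero_re] at h
    have h2 : ‖S.Minv (S.ofXM x)‖ ^ 2 ≤ 0 := nonpos_of_mul_nonpos_right h hc
    have h3 : S.Minv (S.ofXM x) = 0 :=
      norm_eq_zero.1 (eq_zero_of_pow_eq_zero (le_antisymm h2 (sq_nonneg _)))
    have h4 := S.M_Minv (S.ofXM x)
    rw [h3, map_zero] at h4
    exact h4.symm

instance : NormedAddCommGroup S.XM := S.coreXM.toNormedAddCommGroup

instance : InnerProductSpace ℂ S.XM := InnerProductSpace.ofCore S.coreXM.toCore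

/-- State space of the position-momentum formulation, `Xh × XM`. -/
abbrev Zh : Type _ := WithLp 2 (S.Xh × S.XM)

/-- State space of the strain-momentum formulation, `Y1 × XM`. -/
abbrev Wh : Type _ := WithLp 2 (S.Y1 × S.XM)

/-- The transformation `diag(A, I)` from `Xh × XM` to `Y1 × XM`. -/
def diagA : S.Zh →ₗ[ℂ] S.Wh where
  toFun z := WithLp.toLp 2 (S.AY1 z.fst, z.snd)
  map_add' z w := by simp [← WithLp.toLp_add]
  map_smul' c z := by simp [← WithLp.toLp_smul]

/-- `diag(I, M⁻¹)` from `Xh × XM` to `Xh × X`. -/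
def diagMinvZ : S.Zh →ₗ[ℂ] WithLp 2 (S.Xh × X) where
  toFun z := WithLp.toLp 2 (z.fst, S.MinvXM z.snd)
  map_add' z w := by simp [← WithLp.toLp_add]
  map_smul' c z := by simp [← WithLp.toLp_smul]

/-- `diag(I, M⁻¹)` from `Y1 × XM` to `Y1 × X`. -/
def diagMinvW : S.Wh →ₗ[ℂ] WithLp 2 (S.Y1 × X) where
  toFun w := WithLp.toLp 2 (w.fst, S.MinvXM w.snd)
  map_add' z w := by simp [← WithLp.toLp_add]
  map_smul' c z := by simp [← WithLp.toLp_smul]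

/-! ### The block operators -/

/-- The domain `{(z₁, z₂) ∈ Xh × Xh | A z₁ ∈ dom B}` in `Xh × X`. -/
def domA : Submodule ℂ (WithLp 2 (S.Xh × X)) where
  carrier := {z | S.AXh z.fst ∈ S.B.domain ∧ z.snd ∈ S.A.domain}
  add_mem' {z w} hz hw := by
    refine ⟨?_, S.A.domain.add_mem hz.2 hw.2⟩
    rw [WithLp.add_fst, map_add]; exact S.B.domain.add_mem hz.1 hw.1
  zero_mem' := by
    refine ⟨?_, S.A.domain.zero_mem⟩
    rw [WithLp.zero_fst, map_zero]; exact S.B.domain.zero_mem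
  smul_mem' c z hz := by
    refine ⟨?_, S.A.domain.smul_mem c hz.2⟩
    rw [WithLp.smul_fst, map_smul]; exact S.B.domain.smul_mem c hz.1

/-- `(z₁, z₂) ↦ A z₁`, with values in `dom B`. -/
def strainA : S.domA →ₗ[ℂ] S.B.domain where
  toFun z := ⟨S.AXh z.1.fst, z.2.1⟩
  map_add' z w := by ext; simp
  map_smul' c z := by ext; simp

/-- `(z₁, z₂) ↦ z₂`, with values in `dom A`. -/
def velA : S.domA →ₗ[ℂ] S.A.domain where
  toFun z := ⟨z.1.snd, z.2.2⟩
  map_add' z w := by ext; simp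
  map_smul' c z := by ext; simp

/-- The domain `(dom B ∩ Y1) × Xh` in `Y1 × X`. -/
def domB1 : Submodule ℂ (WithLp 2 (S.Y1 × X)) where
  carrier := {w | (w.fst : Y) ∈ S.B.domain ∧ w.snd ∈ S.A.domain}
  add_mem' hz hw := ⟨S.B.domain.add_mem hz.1 hw.1, S.A.domain.add_mem hz.2 hw.2⟩
  zero_mem' := ⟨S.B.domain.zero_mem, S.A.domain.zero_mem⟩
  smul_mem' c _ hz := ⟨S.B.domain.smul_mem c hz.1, S.A.domain.smul_mem c hz.2⟩

/-- `(w₁, w₂) ↦ w₁`, with values in `dom B`. -/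
def strainB : S.domB1 →ₗ[ℂ] S.B.domain where
  toFun w := ⟨w.1.fst, w.2.1⟩
  map_add' z w := by ext; simp
  map_smul' c z := by ext; simp

/-- `(w₁, w₂) ↦ w₂`, with values in `dom A`. -/
def velB : S.domB1 →ₗ[ℂ] S.A.domain where
  toFun w := ⟨w.1.snd, w.2.2⟩
  map_add' z w := by ext; simp
  map_smul' c z := by ext; simp

/-- The domain `{(z₁, z₂) ∈ Xh × M Xh | A z₁ ∈ dom B}` of the position-momentum operator:
all `z` with `(z₁, M⁻¹ z₂) ∈ domA`. -/
def domAM : Submodule ℂ S.Zh := S.domA.comap S.diagMinvZ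

/-- `diag(I, M⁻¹)` on `domAM`. -/
def massA : S.domAM →ₗ[ℂ] S.domA :=
  S.diagMinvZ.restrict fun _ hz => hz

/-- The position-momentum operator `[[0, M⁻¹], [B A, -D M⁻¹]]` on `domAM`. -/
def opAM : S.domAM →ₗ[ℂ] S.Zh :=
  (WithLp.linearEquiv 2 ℂ (S.Xh × S.XM)).symm.toLinearMap ∘ₗ
    ((S.toXh ∘ₗ S.velA).prod
      (S.toXM ∘ₗ (S.B.toFun ∘ₗ S.strainA
        - S.D.toLinearMap ∘ₗ S.A.domain.subtype ∘ₗ S.velA))) ∘ₗ S.massA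

/-- The domain of the strain-momentum operator: all `(w₁, w₂) ∈ Y1 × XM` with
`w₁ ∈ dom B` and `M⁻¹ w₂ ∈ Xh`, i.e. the image of `domAM` under `diag(A, I)`. -/
def domBM : Submodule ℂ S.Wh := S.domB1.comap S.diagMinvW

/-- `diag(I, M⁻¹)` on `domBM`. -/
def massB : S.domBM →ₗ[ℂ] S.domB1 :=
  S.diagMinvW.restrict fun _ hw => hw

/-- The strain-momentum operator `[[0, A M⁻¹], [B, -D M⁻¹]]` on `domBM`. -/
def opBM : S.domBM →ₗ[ℂ] S.Wh :=
  (WithLp.linearEquiv 2 ℂ (S.Y1 × S.XM)).symm.toLinearMap ∘ₗ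
    ((S.AY1 ∘ₗ S.toXh ∘ₗ S.velB).prod
      (S.toXM ∘ₗ (S.B.toFun ∘ₗ S.strainB
        - S.D.toLinearMap ∘ₗ S.A.domain.subtype ∘ₗ S.velB))) ∘ₗ S.massB

end Spaces

end System

/-! ### Boundary triplets and the two boundary nodes -/

/-- A boundary triplet `(G₁ × G₂, Λ, Π)` for the dual pair `(A^*, -B^*)`. Inner products are
linear in the first argument in the mathematical notation, so `⟨a, b⟩` is `⟪b, a⟫_ℂ`; the pairing
`⟨g, f⟩` of `g ∈ G₂` with `f ∈ G₂^*` is the complex conjugate of `f g`. -/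
structure PairTriplet {X Y : Type*} [NormedAddCommGroup X] [InnerProductSpace ℂ X]
    [NormedAddCommGroup Y] [InnerProductSpace ℂ Y] (A : X →ₗ.[ℂ] Y) (B : Y →ₗ.[ℂ] X)
    (G₁ G₂ : Type*) [NormedAddCommGroup G₁] [InnerProductSpace ℂ G₁]
    [NormedAddCommGroup G₂] [InnerProductSpace ℂ G₂] where
  Λ₁ : A.domain →ₗ[ℂ] G₁
  Λ₂ : A.domain →ₗ[ℂ] AntiDual G₂
  Pi₁ : B.domain →ₗ[ℂ] AntiDual G₁
  Pi₂ : B.domain →ₗ[ℂ] G₂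
  surjective_Λ : Function.Surjective (Λ₁.prod Λ₂)
  surjective_Pi : Function.Surjective (Pi₁.prod Pi₂)
  /-- `-⟨B y, x⟩ - ⟨y, A x⟩ = ⟨Pi₁ y, Λ₁ x⟩ - ⟨Pi₂ y, Λ₂ x⟩` -/
  green : ∀ (y : B.domain) (x : A.domain),
    -⟪(x : X), B y⟫_ℂ - ⟪A x, (y : Y)⟫_ℂ
      = Pi₁ y (Λ₁ x) - (starRingEnd ℂ) (Λ₂ x (Pi₂ y))

section Nodes

variable {X Y G₁ G₂ : Type*} [NormedAddCommGroup X] [InnerProductSpace ℂ X] [CompleteSpace X]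
  [NormedAddCommGroup Y] [InnerProductSpace ℂ Y] [CompleteSpace Y]
  [NormedAddCommGroup G₁] [InnerProductSpace ℂ G₁] [NormedAddCommGroup G₂]
  [InnerProductSpace ℂ G₂] (S : System X Y) (T : PairTriplet S.A S.B G₁ G₂)

/-- `Γ₀ z = (Λ₁ z₂, Pi₂ A z₁)`, with values in `G₁ × G₂`. -/
def PairTriplet.Γ₀ : S.domA →ₗ[ℂ] WithLp 2 (G₁ × G₂) :=
  (WithLp.linearEquiv 2 ℂ (G₁ × G₂)).symm.toLinearMap ∘ₗ
    (T.Λ₁ ∘ₗ S.velA).prod (T.Pi₂ ∘ₗ S.strainA)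

/-- `Γ₁ z = (-Pi₁ A z₁, Λ₂ z₂)`, with values in `(G₁ × G₂)^*`. -/
def PairTriplet.Γ₁ : S.domA →ₗ[ℂ] AntiDual (WithLp 2 (G₁ × G₂)) :=
  antiDualProd G₁ G₂ ∘ₗ (-(T.Pi₁ ∘ₗ S.strainA)).prod (T.Λ₂ ∘ₗ S.velA)

/-- `Ξ₀ w = (Λ₁ w₂, Pi₂ w₁)`, with values in `G₁ × G₂`. -/
def PairTriplet.Ξ₀ : S.domB1 →ₗ[ℂ] WithLp 2 (G₁ × G₂) :=
  (WithLp.linearEquiv 2 ℂ (G₁ × G₂)).symm.toLinearMap ∘ₗ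
    (T.Λ₁ ∘ₗ S.velB).prod (T.Pi₂ ∘ₗ S.strainB)

/-- `Ξ₁ w = (-Pi₁ w₁, Λ₂ w₂)`, with values in `(G₁ × G₂)^*`. -/
def PairTriplet.Ξ₁ : S.domB1 →ₗ[ℂ] AntiDual (WithLp 2 (G₁ × G₂)) :=
  antiDualProd G₁ G₂ ∘ₗ (-(T.Pi₁ ∘ₗ S.strainB)).prod (T.Λ₂ ∘ₗ S.velB)

/-- The combination `½ ((1 - P) R γ₀ + (1 + P) γ₁)`, with the Riesz map `R`. -/
def robin {G E : Type*} [NormedAddCommGroup G] [InnerProductSpace ℂ G]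
    [AddCommGroup E] [Module ℂ E] (P : AntiDual G →L[ℂ] AntiDual G)
    (γ₀ : E →ₗ[ℂ] G) (γ₁ : E →ₗ[ℂ] AntiDual G) : E →ₗ[ℂ] AntiDual G :=
  (1 / 2 : ℂ) • ((1 - P).toLinearMap ∘ₗ (riesz G).toLinearMap ∘ₗ γ₀ + (1 + P).toLinearMap ∘ₗ γ₁)

/-- The position-momentum boundary node: input `½((1-P) R Γ₀ + (1+P) Γ₁) diag(I, M⁻¹)`, output
`½((1+P) R Γ₀ + (1-P) Γ₁) diag(I, M⁻¹)`. -/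
def nodeN (P : AntiDual (WithLp 2 (G₁ × G₂)) →L[ℂ] AntiDual (WithLp 2 (G₁ × G₂))) :
    Colligation (AntiDual (WithLp 2 (G₁ × G₂))) S.Zh (AntiDual (WithLp 2 (G₁ × G₂))) where
  dom := S.domAM
  G := robin P (T.Γ₀ S) (T.Γ₁ S) ∘ₗ S.massA
  L := S.opAM
  K := robin (-P) (T.Γ₀ S) (T.Γ₁ S) ∘ₗ S.massA

/-- The strain-momentum boundary node: input `½((1-P) R Ξ₀ + (1+P) Ξ₁) diag(I, M⁻¹)`, output
`½((1+P) R Ξ₀ + (1-P) Ξ₁) diag(I, M⁻¹)`. -/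
def nodeL (P : AntiDual (WithLp 2 (G₁ × G₂)) →L[ℂ] AntiDual (WithLp 2 (G₁ × G₂))) :
    Colligation (AntiDual (WithLp 2 (G₁ × G₂))) S.Wh (AntiDual (WithLp 2 (G₁ × G₂))) where
  dom := S.domBM
  G := robin P (T.Ξ₀ S) (T.Ξ₁ S) ∘ₗ S.massB
  L := S.opBM
  K := robin (-P) (T.Ξ₀ S) (T.Ξ₁ S) ∘ₗ S.massB

end Nodes

end SecondOrder

end

/-! Everything rests on an energy estimate for the strain-momentum node `L`. The difference of two
solutions with equal input and initial state stays in the kernel of the input operator, so if the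
interior operator is dissipative there (`nodeL_dissipative`), its squared norm is nonincreasing,
starts at zero, and vanishes (`eqOn_of_dissipative`).

For dissipativity, let `e` be the strain and `v = M⁻¹ w₂` the velocity. In the weighted inner
product the power is `Re(⟨A v, e⟩ + ⟨B e, v⟩)` minus the damping loss `Re⟨D v, v⟩ ≥ 0`. Green's
identity turns the first term into the boundary pairing of `Ξ₁` with `Ξ₀`. On the kernel, `P`
carries `R(x - b)` to `R(x + b)`, where `x = Ξ₀ w` and `R b = Ξ₁ w`; a contraction thus forces
`Re⟨x, b⟩ ≤ 0`.

The node `N` is handled by transport: `diag(A, I)` is an isometry intertwining the two nodes, so it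
carries solutions of `N` to solutions of `L`, and its injectivity pulls uniqueness back to `N`. -/

namespace SecondOrder

/-! ### Riesz map and contractive boundary relations -/

section AntiDual

variable {G : Type*} [NormedAddCommGroup G] [InnerProductSpace ℂ G]

theorem riesz_apply (x g : G) : riesz G x g = ⟪g, x⟫_ℂ := rfl

theorem norm_riesz (x : G) : ‖riesz G x‖ = ‖x‖ := by
  refine le_antisymm
    (ContinuousLinearMap.opNorm_le_bound _ (norm_nonneg _) fun g => ?_) ?_
  · rw [riesz_apply, mul_comm]
    exact norm_inner_le_norm _ _
  -- Testing the functional on `x` itself gives `‖x‖ * ‖x‖ ≤ ‖R x‖ * ‖x‖`; one factor cancels unless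
  -- `x` has norm zero.
  · have h := (riesz G x).le_opNorm x
    rw [riesz_apply, inner_self_eq_norm_sq_to_K, norm_pow, RCLike.norm_ofReal, abs_norm, sq] at h
    rcases (norm_nonneg x).eq_or_lt with h0 | h0
    · rw [← h0]; exact norm_nonneg _
    · exact le_of_mul_le_mul_right h h0

theorem riesz_surjective [CompleteSpace G] : Function.Surjective (riesz G) := by
  intro f
  -- Conjugating the values makes `f` linear, so that the Fréchet-Riesz theorem applies.
  let f' : StrongDual ℂ G := (starL ℂ : ℂ ≃L⋆[ℂ] ℂ).toContinuousLinearMap.comp f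
  refine ⟨(InnerProductSpace.toDual ℂ G).symm f', ?_⟩
  ext g
  rw [riesz_apply, ← inner_conj_symm, InnerProductSpace.toDual_symm_apply]
  exact star_star (f g)

/-- If the Cayley-type combination `(1 - P) R x + (1 + P) f` vanishes for a contraction `P`,
then the pairing of `f` with `x` has nonpositive real part. -/
theorem re_apply_nonpos_of_contraction [CompleteSpace G] (P : AntiDual G →L[ℂ] AntiDual G)
    (hP : ‖P‖ ≤ 1) (x : G) (f : AntiDual G)
    (h : (1 - P) (riesz G x) + (1 + P) f = 0) : (f x).re ≤ 0 := by
  obtain ⟨b, rfl⟩ := riesz_surjective f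
  have h1 : riesz G (x + b) = P (riesz G (x - b)) := by
    simp only [sub_apply, add_apply, one_apply_eq_self] at h
    rw [map_add, map_sub, map_sub, ← sub_eq_zero, ← h]
    abel
  have h2 : ‖x + b‖ ≤ ‖x - b‖ := by
    rw [← norm_riesz, ← norm_riesz (x - b), h1]
    exact P.le_of_opNorm_le_of_le hP le_rfl |>.trans_eq (one_mul _)
  -- The two expansions differ by `4 Re⟨x, b⟩`, so `‖x + b‖ ≤ ‖x - b‖` says that this is
  -- nonpositive.
  have h3 := norm_add_sq (𝕜 := ℂ) x b
  have h4 := norm_sub_sq (𝕜 := ℂ) x b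
  have h5 : ‖x + b‖ ^ 2 ≤ ‖x - b‖ ^ 2 := by gcongr
  rw [riesz_apply]
  change RCLike.re ⟪x, b⟫_ℂ ≤ 0
  linarith

end AntiDual

/-! ### Uniqueness by dissipativity and transport of classical solutions -/

namespace Colligation

variable {U Z V : Type*} [NormedAddCommGroup U] [NormedSpace ℂ U]
  [NormedAddCommGroup Z] [InnerProductSpace ℂ Z] [NormedAddCommGroup V] [NormedSpace ℂ V]

/-- Classical solutions are determined by input and initial state if the interior operator is
dissipative on the kernel of the input operator. -/
theorem IsClassicalSolution.eqOn_of_dissipative {Θ : Colligation U Z V}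
    (hΘ : ∀ x : Θ.dom, Θ.G x = 0 → (⟪(x : Z), Θ.L x⟫_ℂ).re ≤ 0)
    {u : ℝ → U} {z z' : ℝ → Z} {y y' : ℝ → V}
    (h : Θ.IsClassicalSolution u z y) (h' : Θ.IsClassicalSolution u z' y') (h0 : z 0 = z' 0) :
    Set.EqOn z z' (Set.Ici 0) ∧ Set.EqOn y y' (Set.Ici 0) := by
  have key : ∀ t : Set.Ici (0 : ℝ), ∃ d : ℝ, d ≤ 0 ∧
      HasDerivWithinAt (fun s => ‖z s - z' s‖ ^ 2) d (Set.Ici 0) t := by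
    intro t
    -- Forming the difference inside the domain lets linearity of `G` and `L` apply to it.
    let x : Θ.dom := ⟨z t, h.mem_dom t⟩ - ⟨z' t, h'.mem_dom t⟩
    have hG : Θ.G x = 0 := by
      rw [map_sub, ← h.input_eq t, ← h'.input_eq t, sub_self]
    have hd : HasDerivWithinAt (fun s => z s - z' s) (Θ.L x) (Set.Ici 0) t := by
      rw [map_sub]
      exact (h.state_eq t).sub (h'.state_eq t)
    have hi := hd.inner ℂ hd
    have hr := (Complex.reCLM.hasFDerivAt (x := ⟪z t - z' t, z t - z' t⟫_ℂ)).comp_hasDerivWithinAt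
      (t : ℝ) hi
    refine ⟨2 * (⟪(x : Z), Θ.L x⟫_ℂ).re, by linarith [hΘ x hG], ?_⟩
    have hf : (fun s => ‖z s - z' s‖ ^ 2)
        = Complex.reCLM ∘ fun s => ⟪z s - z' s, z s - z' s⟫_ℂ :=
      funext fun s => norm_sq_eq_re_inner (𝕜 := ℂ) (z s - z' s)
    -- The two terms of the product rule are complex conjugates, which yields the factor 2.
    have hc : (⟪Θ.L x, (x : Z)⟫_ℂ).re = (⟪(x : Z), Θ.L x⟫_ℂ).re :=
      inner_re_symm (𝕜 := ℂ) _ _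
    have hv : 2 * (⟪(x : Z), Θ.L x⟫_ℂ).re
        = Complex.reCLM (⟪z t - z' t, Θ.L x⟫_ℂ + ⟪Θ.L x, z t - z' t⟫_ℂ) := by
      change _ = (⟪(x : Z), Θ.L x⟫_ℂ + ⟪Θ.L x, (x : Z)⟫_ℂ).re
      rw [Complex.add_re, hc, two_mul]
    rw [hf, hv]
    exact hr
  choose d hd0 hd using key
  have hanti : AntitoneOn (fun s => ‖z s - z' s‖ ^ 2) (Set.Ici (0 : ℝ)) := by
    -- The value 0 at negative times is a dummy: the derivative is only inspected in the interior of
    -- `[0, ∞)`.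
    refine antitoneOn_of_hasDerivWithinAt_nonpos (f' := fun t => if ht : 0 ≤ t then d ⟨t, ht⟩ else 0)
      (convex_Ici 0) (fun t ht => (hd ⟨t, ht⟩).continuousWithinAt) (fun t ht => ?_)
      (fun t ht => ?_)
    all_goals
      have ht' : 0 ≤ t := interior_subset ht
      simp only [ht', dif_pos]
    · exact (hd ⟨t, ht'⟩).mono interior_subset
    · exact hd0 _
  have hz : Set.EqOn z z' (Set.Ici 0) := by
    intro t ht
    have h1 := hanti Set.self_mem_Ici ht ht
    simp only [h0, sub_self, norm_zero] at h1
    have h2 : ‖z t - z' t‖ = 0 := by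
      nlinarith [norm_nonneg (z t - z' t)]
    exact sub_eq_zero.1 (norm_eq_zero.1 h2)
  refine ⟨hz, fun t ht => ?_⟩
  rw [h.output_eq ⟨t, ht⟩, h'.output_eq ⟨t, ht⟩]
  congr 1
  exact Subtype.ext (hz ht)

/-- A bounded operator intertwining two colligations maps classical solutions to classical
solutions. -/
theorem IsClassicalSolution.map {W : Type*} [NormedAddCommGroup W] [NormedSpace ℂ W]
    {Θ : Colligation U Z V} {Ψ : Colligation U W V} (F : Z →L[ℂ] W)
    (hdom : ∀ x ∈ Θ.dom, F x ∈ Ψ.dom)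
    (hG : ∀ x : Θ.dom, Ψ.G ⟨F x, hdom x x.2⟩ = Θ.G x)
    (hL : ∀ x : Θ.dom, Ψ.L ⟨F x, hdom x x.2⟩ = F (Θ.L x))
    (hK : ∀ x : Θ.dom, Ψ.K ⟨F x, hdom x x.2⟩ = Θ.K x)
    {u : ℝ → U} {z : ℝ → Z} {y : ℝ → V} (h : Θ.IsClassicalSolution u z y) :
    Ψ.IsClassicalSolution u (fun t => F (z t)) y where
  contDiffOn_input := h.contDiffOn_input
  contDiffOn_state := (F.restrictScalars ℝ).contDiff.comp_contDiffOn h.contDiffOn_state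
  continuousOn_output := h.continuousOn_output
  mem_dom t := hdom _ (h.mem_dom t)
  continuous_graph := by
    have h1 := (F.continuous.comp h.continuous_graph.fst).prodMk
      (F.continuous.comp h.continuous_graph.snd)
    convert h1 using 2 with t
    exact Prod.ext rfl (hL ⟨z t, h.mem_dom t⟩)
  input_eq t := (h.input_eq t).trans (hG ⟨z t, h.mem_dom t⟩).symm
  state_eq t := by
    rw [hL ⟨z t, h.mem_dom t⟩]
    exact (F.restrictScalars ℝ).hasFDerivAt.comp_hasDerivWithinAt (t : ℝ) (h.state_eq t)
  output_eq t := (h.output_eq t).trans (hK ⟨z t, h.mem_dom t⟩).symm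

end Colligation

/-! ### The isometry `diag(A, I)` and the interior power balance -/

namespace System

variable {X Y : Type*} [NormedAddCommGroup X] [InnerProductSpace ℂ X] [CompleteSpace X]
  [NormedAddCommGroup Y] [InnerProductSpace ℂ Y] [CompleteSpace Y] (S : System X Y)

/-- The transformation `diag(A, I)` as a linear isometry. -/
def diagAIsometry : S.Zh →ₗᵢ[ℂ] S.Wh where
  toLinearMap := S.diagA
  norm_map' z := by
    rw [WithLp.prod_norm_eq_of_L2, WithLp.prod_norm_eq_of_L2]
    -- The norm of `Xh` is by definition the norm of `A x` in `Y`, so the two sides agree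
    -- componentwise.
    rfl

/-- Damping only removes energy; what remains on the right is exactly the expression that Green's
identity converts into boundary terms. -/
theorem re_inner_opBM_le (w : S.domBM) :
    (⟪(w : S.Wh), S.opBM w⟫_ℂ).re ≤
      (⟪(S.strainB (S.massB w) : Y), S.A (S.velB (S.massB w))⟫_ℂ
        + ⟪(S.velB (S.massB w) : X), S.B (S.strainB (S.massB w))⟫_ℂ).re := by
  set e := S.strainB (S.massB w)
  set v := S.velB (S.massB w)
  -- The weight `M⁻¹` in the inner product of `XM` replaces the momentum by the velocity `v`, hence
  -- the identity is definitional.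
  have h : ⟪(w : S.Wh), S.opBM w⟫_ℂ
      = ⟪(e : Y), S.A v⟫_ℂ + ⟪(v : X), S.B e - S.D v⟫_ℂ := rfl
  have hD := S.dissipative_D v
  rw [inner_neg_left, Complex.neg_re] at hD
  have hs : (⟪(v : X), S.D v⟫_ℂ).re = (⟪S.D v, (v : X)⟫_ℂ).re := inner_re_symm (𝕜 := ℂ) _ _
  rw [h, inner_sub_right, Complex.add_re, Complex.add_re, Complex.sub_re]
  linarith

end System

/-! ### Boundary power balance and comparison of the two nodes -/

section Nodes

variable {X Y G₁ G₂ : Type*} [NormedAddCommGroup X] [InnerProductSpace ℂ X] [CompleteSpace X]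
  [NormedAddCommGroup Y] [InnerProductSpace ℂ Y] [CompleteSpace Y]
  [NormedAddCommGroup G₁] [InnerProductSpace ℂ G₁] [NormedAddCommGroup G₂]
  [InnerProductSpace ℂ G₂] (S : System X Y) (T : PairTriplet S.A S.B G₁ G₂)

/-- This is the real part of Green's identity: taking real parts removes the conjugation in the `G₂`
pairing, and the sign in `Ξ₁` matches the two sides. -/
theorem PairTriplet.re_Ξ₁_Ξ₀ (x : S.domB1) :
    (T.Ξ₁ S x (T.Ξ₀ S x)).re = (⟪(S.strainB x : Y), S.A (S.velB x)⟫_ℂ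
        + ⟪(S.velB x : X), S.B (S.strainB x)⟫_ℂ).re := by
  have h : T.Ξ₁ S x (T.Ξ₀ S x) = -T.Pi₁ (S.strainB x) (T.Λ₁ (S.velB x))
      + T.Λ₂ (S.velB x) (T.Pi₂ (S.strainB x)) := rfl
  have hg := congrArg Complex.re (T.green (S.strainB x) (S.velB x))
  have hs : (⟪(S.strainB x : Y), S.A (S.velB x)⟫_ℂ).re
      = (⟪S.A (S.velB x), (S.strainB x : Y)⟫_ℂ).re := inner_re_symm (𝕜 := ℂ) _ _
  simp only [Complex.sub_re, Complex.neg_re, Complex.conj_re] at hg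
  rw [h, Complex.add_re, Complex.add_re, Complex.neg_re]
  linarith

/-- The strain-momentum operator is dissipative on the kernel of the input operator. -/
theorem nodeL_dissipative [CompleteSpace G₁] [CompleteSpace G₂]
    (P : AntiDual (WithLp 2 (G₁ × G₂)) →L[ℂ] AntiDual (WithLp 2 (G₁ × G₂))) (hP : ‖P‖ ≤ 1)
    (w : (nodeL S T P).dom) (hw : (nodeL S T P).G w = 0) :
    (⟪(w : S.Wh), (nodeL S T P).L w⟫_ℂ).re ≤ 0 := by
  refine (S.re_inner_opBM_le w).trans ?_
  rw [← T.re_Ξ₁_Ξ₀ S (S.massB w)]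
  refine re_apply_nonpos_of_contraction P hP _ _ ?_
  have hw' : (1 / 2 : ℂ) • ((1 - P) (riesz _ (T.Ξ₀ S (S.massB w)))
      + (1 + P) (T.Ξ₁ S (S.massB w))) = 0 := hw
  exact (smul_eq_zero.1 hw').resolve_left (by norm_num)

/-- `diag(A, I)` maps solutions of the position-momentum node to solutions of the
strain-momentum node. -/
theorem nodeN_solution_map
    (P : AntiDual (WithLp 2 (G₁ × G₂)) →L[ℂ] AntiDual (WithLp 2 (G₁ × G₂)))
    {u y : ℝ → AntiDual (WithLp 2 (G₁ × G₂))} {z : ℝ → S.Zh}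
    (h : (nodeN S T P).IsClassicalSolution u z y) :
    (nodeL S T P).IsClassicalSolution u (fun t => S.diagA (z t)) y :=
  h.map (Ψ := nodeL S T P) S.diagAIsometry.toContinuousLinearMap (fun _ hx => hx)
    -- Both nodes see `z₁` in boundary values and momentum balance only through `A z₁`, so
    -- intertwining is definitional.
    (fun _ => rfl) (fun _ => rfl) (fun _ => rfl)

end Nodes

end SecondOrder

/-! ### The main theorem -/

theorem corollary3p12 {X Y G₁ G₂ : Type*}
    [NormedAddCommGroup X] [InnerProductSpace ℂ X] [CompleteSpace X]
    [NormedAddCommGroup Y] [InnerProductSpace ℂ Y] [CompleteSpace Y]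
    [NormedAddCommGroup G₁] [InnerProductSpace ℂ G₁] [CompleteSpace G₁]
    [NormedAddCommGroup G₂] [InnerProductSpace ℂ G₂] [CompleteSpace G₂]
    (S : SecondOrder.System X Y) (T : SecondOrder.PairTriplet S.A S.B G₁ G₂)
    (P : SecondOrder.AntiDual (WithLp 2 (G₁ × G₂)) →L[ℂ]
      SecondOrder.AntiDual (WithLp 2 (G₁ × G₂)))
    (hP : ‖P‖ ≤ 1)
    (z₀ : S.Zh) (u y : ℝ → SecondOrder.AntiDual (WithLp 2 (G₁ × G₂))) (z : ℝ → S.Zh)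
    (hN : (SecondOrder.nodeN S T P).IsClassicalSolution u z y) (hz₀ : z 0 = z₀) :
    -- `(u, z, y)` is the only classical solution of `N` with input `u` and initial state `z₀`
    (∀ (z' : ℝ → S.Zh) (y' : ℝ → SecondOrder.AntiDual (WithLp 2 (G₁ × G₂))),
      (SecondOrder.nodeN S T P).IsClassicalSolution u z' y' → z' 0 = z₀ →
        Set.EqOn z' z (Set.Ici 0) ∧ Set.EqOn y' y (Set.Ici 0)) ∧
    -- `(u, diag(A, I) z, y)` is a classical solution of `L` with initial state `diag(A, I) z₀`
    ((SecondOrder.nodeL S T P).IsClassicalSolution u (fun t => S.diagA (z t)) y ∧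
      S.diagA (z 0) = S.diagA z₀) ∧
    -- and it is the only one with input `u` and this initial state
    (∀ (w : ℝ → S.Wh) (v : ℝ → SecondOrder.AntiDual (WithLp 2 (G₁ × G₂))),
      (SecondOrder.nodeL S T P).IsClassicalSolution u w v → w 0 = S.diagA z₀ →
        Set.EqOn w (fun t => S.diagA (z t)) (Set.Ici 0) ∧ Set.EqOn v y (Set.Ici 0)) := by
  have hL := SecondOrder.nodeN_solution_map S T P hN
  have hdiss := SecondOrder.nodeL_dissipative S T P hP
  refine ⟨fun z' y' h' h0 => ?_, ⟨hL, congrArg _ hz₀⟩, fun w v hw h0 => ?_⟩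
  -- Uniqueness for `N` is obtained by comparing the images of both solutions in `L`.
  · have h := (SecondOrder.nodeN_solution_map S T P h').eqOn_of_dissipative hdiss hL
      (by rw [h0, hz₀])
    exact ⟨fun t ht => S.diagAIsometry.injective (h.1 ht), h.2⟩
  · exact hw.eqOn_of_dissipative hdiss hL (by rw [h0, hz₀])
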